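/- Let $n \ge 0$ be an integer. The type $C$ Catalan arrangement in $\mathbb{R}^n$ is the set of all hyperplanes $$\{x : x_i - x_j = s\},\qquad \{x : x_i + x_j = s\}\quad (1 \le i < j \le n),\qquad \{x : 2x_i = s\}\quad (1 \le i \le n),$$ where $s \in \{-1,0,1\}$. Its regions are the connected components of the complement in $\mathbb{R}^n$ of the union of these hyperplanes. The number of regions of the type $C$ Catalan arrangement in $\mathbb{R}^n$ is finite and equal to $$2^n\, n!\, \binom{2n}{n}.$$ -/

import Mathlib

/-- The type `C` Catalan arrangement in `ℝⁿ`: the set of the hyperplanes `x_i - x_j = s` and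
`x_i + x_j = s` (for `i < j`) and `2 x_i = s` (for every `i`), where `s ∈ {-1, 0, 1}`. -/
def typeCCatalanArrangement (n : ℕ) : Set (Set (Fin n → ℝ)) :=
  {H | ∃ s ∈ ({-1, 0, 1} : Set ℝ),
    (∃ i j : Fin n, i < j ∧ H = {x | x i - x j = s}) ∨
    (∃ i j : Fin n, i < j ∧ H = {x | x i + x j = s}) ∨
    (∃ i : Fin n, H = {x | 2 * x i = s})}

/-- The regions of a set `A` of subsets (hyperplanes) of `ℝⁿ`: the connected components of the
complement of the union of the members of `A`, as subsets of `ℝⁿ`. -/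
def arrangementRegions {n : ℕ} (A : Set (Set (Fin n → ℝ))) : Set (Set (Fin n → ℝ)) :=
  {R | ∃ x ∈ (⋃₀ A)ᶜ, R = connectedComponentIn (⋃₀ A)ᶜ x}

/-! Signed permutations of the coordinates preserve the arrangement, and a generic point has nonzero
coordinates with distinct absolute values. So each region lies in exactly one of the `2 ^ n * n!`
images of the dominant chamber `0 < x 0 < ... < x (n - 1)`, and it remains to find `(2 * n).choose
n` regions inside that chamber.

There the numbers `± x i` form an increasing sequence `y` with `y (-1 - j) = -y j`, and a region
amounts to knowing which pairs satisfy `y a + 1 < y b`. By monotonicity and reflection this is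
recorded by the window sizes: for each `k`, the number of `j` in `[-1 - k, k]` with `y k < y j + 1`.
From one `k` to the next the window grows by at most one, unless it already held all `2 * k` earlier
numbers; then `-x k` may enter as well. Every point obeys this rule (`exists_mem_cellCodes`), every
word obeying it is realized (`exists_next_coordinate`), and ballot numbers count the words
(`card_cellCodes`). Regions become sign patterns through `connectedComponentIn_eq_signCell`. -/

/-! ### Counting codes of dominant cells -/

/-- The values that may follow the value `t` in position `k` of a code. -/
def nextValues (k t : ℕ) : Finset ℕ := Finset.Icc 1 (if t = 2 * k then 2 * k + 2 else t + 1)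

/-- The codes of length `n`, in reverse order. -/
def cellCodes : ℕ → Finset (List ℕ)
  | 0 => {[]}
  | n + 1 => (cellCodes n).biUnion fun c => (nextValues n (c.headD 0)).image (· :: c)

lemma mem_cellCodes_succ {n : ℕ} {c : List ℕ} :
    c ∈ cellCodes (n + 1) ↔
      ∃ d ∈ cellCodes n, ∃ u ∈ nextValues n (d.headD 0), u :: d = c := by
  simp [cellCodes]

lemma length_of_mem_cellCodes {n : ℕ} {c : List ℕ} (h : c ∈ cellCodes n) : c.length = n := by
  induction n generalizing c with
  | zero => simp_all [cellCodes]
  | succ n ih =>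
    obtain ⟨d, hd, u, -, rfl⟩ := mem_cellCodes_succ.1 h
    simp [ih hd]

lemma headD_le_of_mem_cellCodes {n : ℕ} {c : List ℕ} (h : c ∈ cellCodes n) :
    c.headD 0 ≤ 2 * n := by
  induction n generalizing c with
  | zero => simp_all [cellCodes]
  | succ n ih =>
    obtain ⟨d, hd, u, hu, rfl⟩ := mem_cellCodes_succ.1 h
    have := ih hd
    simp only [nextValues, Finset.mem_Icc] at hu
    simp only [List.headD_cons]
    split_ifs at hu <;> omega

/-- The number of ways to extend by `r` values a code of length `k` that ends in `t`. -/
def extensionCount : ℕ → ℕ → ℕ → ℕ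
  | 0, _, _ => 1
  | r + 1, k, t => ∑ u ∈ nextValues k t, extensionCount r (k + 1) u

lemma sum_cellCodes_succ (n : ℕ) (f : List ℕ → ℕ) :
    ∑ c ∈ cellCodes (n + 1), f c =
      ∑ c ∈ cellCodes n, ∑ u ∈ nextValues n (c.headD 0), f (u :: c) := by
  rw [cellCodes, Finset.sum_biUnion]
  · refine Finset.sum_congr rfl fun c _ => ?_
    rw [Finset.sum_image]
    intro a _ b _ h
    simpa using h
  · intro c _ d _ hcd
    rw [Function.onFun, Finset.disjoint_left]
    intro l hl hl'
    simp only [Finset.mem_image] at hl hl'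
    obtain ⟨u, -, rfl⟩ := hl
    obtain ⟨v, -, hv⟩ := hl'
    simp at hv
    exact hcd hv.2.symm

lemma sum_extensionCount (n r : ℕ) :
    ∑ c ∈ cellCodes n, extensionCount r n (c.headD 0) = extensionCount (n + r) 0 0 := by
  induction n generalizing r with
  | zero => simp [cellCodes]
  | succ n ih =>
    rw [sum_cellCodes_succ, show n + 1 + r = n + (r + 1) by ring, ← ih (r + 1)]
    rfl

/-- Ballot numbers `C(2r+t, r) - C(2r+t, r-1)`. -/
def ballotNumber : ℕ → ℕ → ℤ
  | 0, _ => 1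
  | r + 1, t => (2 * (r + 1) + t).choose (r + 1) - (2 * (r + 1) + t).choose r

lemma ballotNumber_succ_zero (r : ℕ) : ballotNumber (r + 1) 0 = ballotNumber r 1 := by
  have hs : (2 * r + 1).choose (r + 1) = (2 * r + 1).choose r :=
    Nat.choose_symm_of_eq_add (by ring)
  cases r with
  | zero => simp [ballotNumber]
  | succ r =>
    simp only [ballotNumber]
    rw [show 2 * (r + 1 + 1) + 0 = (2 * (r + 1) + 1) + 1 by ring,
      Nat.choose_succ_succ (2 * (r + 1) + 1) (r + 1), Nat.choose_succ_succ (2 * (r + 1) + 1) r, hs]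
    push_cast
    ring

/-- Pascal's rule on both binomials; this recurrence telescopes in `sum_ballotNumber`. -/
lemma ballotNumber_succ_succ (r t : ℕ) :
    ballotNumber (r + 1) (t + 1) = ballotNumber (r + 1) t + ballotNumber r (t + 2) := by
  cases r with
  | zero => simp [ballotNumber]; ring
  | succ r =>
    simp only [ballotNumber]
    rw [show 2 * (r + 1 + 1) + (t + 1) = (2 * (r + 1 + 1) + t) + 1 by ring,
      Nat.choose_succ_succ _ (r + 1), Nat.choose_succ_succ _ r,
      show 2 * (r + 1) + (t + 2) = 2 * (r + 1 + 1) + t by ring]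
    push_cast
    ring

lemma sum_ballotNumber (r t : ℕ) :
    ∑ u ∈ Finset.Icc 1 (t + 1), ballotNumber r u = ballotNumber (r + 1) t := by
  induction t with
  | zero => simp [ballotNumber_succ_zero]
  | succ t ih => rw [Finset.sum_Icc_succ_top (by omega), ih, ballotNumber_succ_succ]

/-- A window that is not full never becomes full again: `u ≤ t + 1 ≤ 2 * k < 2 * (k + 1)`. -/
lemma extensionCount_of_lt (r k t : ℕ) (h : t < 2 * k) :
    (extensionCount r k t : ℤ) = ballotNumber r t := by
  induction r generalizing k t with
  | zero => simp [extensionCount, ballotNumber]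
  | succ r ih =>
    rw [extensionCount, ← sum_ballotNumber, nextValues, if_neg h.ne]
    push_cast
    refine Finset.sum_congr rfl fun u hu => ih _ _ ?_
    have := (Finset.mem_Icc.1 hu).2
    omega

/-- The non-full successors contribute a difference of binomials, whose subtracted term is exactly
the contribution of the full successor `2 * k + 2`. -/
lemma extensionCount_two_mul (r k : ℕ) :
    extensionCount r k (2 * k) = (2 * r + 2 * k).choose r := by
  induction r generalizing k with
  | zero => simp [extensionCount]
  | succ r ih =>
    have h : (∑ u ∈ Finset.Icc 1 (2 * k + 1), (extensionCount r (k + 1) u : ℤ)) =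
        ballotNumber (r + 1) (2 * k) := by
      rw [← sum_ballotNumber]
      refine Finset.sum_congr rfl fun u hu => extensionCount_of_lt _ _ _ ?_
      have := (Finset.mem_Icc.1 hu).2
      omega
    zify
    rw [extensionCount, nextValues, if_pos rfl, Finset.sum_Icc_succ_top (by omega)]
    push_cast
    rw [h, show 2 * k + 1 + 1 = 2 * (k + 1) by ring, ih, ballotNumber,
      show 2 * r + 2 * (k + 1) = 2 * (r + 1) + 2 * k by ring]
    ring

lemma card_cellCodes (n : ℕ) : (cellCodes n).card = (2 * n).choose n := by
  have h := sum_extensionCount n 0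
  -- The empty code has default head `0 = 2 * 0`, so it counts as full.
  have h' := extensionCount_two_mul n 0
  simp only [extensionCount, Finset.sum_const, smul_eq_mul, mul_one] at h
  simpa [h] using h'

/-! ### Codes of dominant points -/

/-- The extension of a sequence `x` to the integers with `x (-1 - j) = -x j`. -/
def oddExtension (x : ℕ → ℝ) (j : ℤ) : ℝ :=
  if 0 ≤ j then x j.toNat else -x (-1 - j).toNat

lemma oddExtension_reflect (x : ℕ → ℝ) (j : ℤ) :
    oddExtension x (-1 - j) = -oddExtension x j := by
  unfold oddExtension
  by_cases h : 0 ≤ j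
  · rw [if_neg (by omega), if_pos h, show -1 - (-1 - j) = j by ring]
  · rw [if_pos (by omega), if_neg h, neg_neg]

@[simp] lemma oddExtension_natCast (x : ℕ → ℝ) (k : ℕ) : oddExtension x k = x k := by
  simp [oddExtension]

/-- The first `n` terms of `x` are positive and increasing. -/
def IsDominant (n : ℕ) (x : ℕ → ℝ) : Prop :=
  ∀ a b : ℤ, -n ≤ a → a < b → b < n → oddExtension x a < oddExtension x b

lemma isDominant_of_pos_of_lt {n : ℕ} {x : ℕ → ℝ} (h0 : ∀ i < n, 0 < x i)
    (h : ∀ i j, i < j → j < n → x i < x j) : IsDominant n x := by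
  intro a b ha hab hb
  unfold oddExtension
  split_ifs with h1 h2 h2
  · exact h _ _ (by omega) (by omega)
  · omega
  · linarith [h0 (-1 - a).toNat (by omega), h0 b.toNat (by omega)]
  · exact neg_lt_neg (h _ _ (by omega) (by omega))

lemma IsDominant.mono {m n : ℕ} {x : ℕ → ℝ} (h : IsDominant n x) (hmn : m ≤ n) :
    IsDominant m x :=
  fun a b ha hab hb => h a b (by omega) hab (by omega)

lemma IsDominant.pos {n : ℕ} {x : ℕ → ℝ} (h : IsDominant n x) {i : ℕ} (hi : i < n) :
    0 < x i := by
  have := h (-1 - i) i (by omega) (by omega) (by omega)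
  rw [oddExtension_reflect, oddExtension_natCast] at this
  linarith

/-- Exactly the `u` largest of the numbers `±x i` with `i ≤ k` exceed `x k - 1`, and none
is equal to it. -/
def IsWindow (x : ℕ → ℝ) (k u : ℕ) : Prop :=
  ∀ j : ℤ, -1 - k ≤ j → j ≤ k →
    (k - j < u → oddExtension x k < oddExtension x j + 1) ∧
    (u ≤ k - j → oddExtension x j + 1 < oddExtension x k)

/-- The list `c`, read from its end, records the windows of `x`. -/
def IsCodeOf (x : ℕ → ℝ) : List ℕ → Prop
  | [] => True
  | u :: c => IsWindow x c.length u ∧ IsCodeOf x c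

lemma oddExtension_congr {x x' : ℕ → ℝ} {k : ℕ} (h : ∀ i < k, x i = x' i) {j : ℤ}
    (hj : -k ≤ j) (hj' : j < k) : oddExtension x j = oddExtension x' j := by
  unfold oddExtension
  split_ifs
  · exact h _ (by omega)
  · rw [h _ (by omega)]

lemma IsWindow.congr {x x' : ℕ → ℝ} {k u : ℕ} (h : ∀ i < k + 1, x i = x' i)
    (hx : IsWindow x k u) : IsWindow x' k u := by
  intro j hj hj'
  have := hx j hj hj'
  rwa [oddExtension_congr h (by omega) (by omega),
    oddExtension_congr h (by push_cast; omega) (by push_cast; omega)] at this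

lemma IsCodeOf.congr {x x' : ℕ → ℝ} {c : List ℕ} (h : ∀ i < c.length, x i = x' i)
    (hx : IsCodeOf x c) : IsCodeOf x' c := by
  induction c with
  | nil => trivial
  | cons u c ih =>
    exact ⟨hx.1.congr h, ih (fun i hi => h i (by simp; omega)) hx.2⟩

/-- The conditions on `v` are finitely many strict lower and upper bounds, compatible because `u` is
an allowed successor of `t`. The bound `1 / 2` decides whether `-v` lies in the window of `v`. -/
lemma exists_next_coordinate {k t u : ℕ} {x : ℕ → ℝ} (hd : IsDominant k x)
    (ht : 0 < k → IsWindow x (k - 1) t) (hu : u ∈ nextValues k t) :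
    ∃ v : ℝ, 0 < v ∧ (∀ j : ℤ, -k ≤ j → j < k → oddExtension x j < v) ∧
      (∀ j : ℤ, -k ≤ j → j < k → (k - j < u → v < oddExtension x j + 1) ∧
        (u ≤ k - j → oddExtension x j + 1 < v)) ∧
      (2 * k + 1 < u → v < 1 / 2) ∧ (u ≤ 2 * k + 1 → 1 / 2 < v) := by
  classical
  set y := oddExtension x with hy
  obtain ⟨hu1, hu2⟩ := Finset.mem_Icc.1 hu
  have htop : ∀ j : ℤ, -k ≤ j → j < k → k - j < u → y (k - 1) < y j + 1 := by
    intro j hj hj' hju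
    have hk : 0 < k := by omega
    have := (ht hk j (by omega) (by omega)).1 (by split_ifs at hu2 <;> omega)
    rwa [Nat.cast_sub (by omega), Nat.cast_one] at this
  have hle : ∀ i : ℤ, -k ≤ i → i < k → y i ≤ y (k - 1) := by
    intro i hi hi'
    rcases eq_or_lt_of_le (show i ≤ k - 1 by omega) with rfl | h
    · exact le_rfl
    · exact (hd _ _ hi h (by omega)).le
  have hge : ∀ i : ℤ, -k ≤ i → i < k → -y (k - 1) ≤ y i := by
    intro i hi hi'
    have := hle (-1 - i) (by omega) (by omega)
    rw [hy, oddExtension_reflect] at this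
    rw [hy]
    linarith
  have hsmall : 0 < k → 2 * k + 1 < u → y (k - 1) < 1 / 2 := by
    intro hk hku
    have h1 := htop (-k) le_rfl (by omega)
    have h2 : y (-k) = -y (k - 1) := by
      rw [hy, ← oddExtension_reflect]
      congr 1
      ring
    have h3 := (ht hk (-k) (by omega) (by omega)).1 (by split_ifs at hu2 <;> omega)
    rw [Nat.cast_sub (by omega), Nat.cast_one] at h3
    change y (k - 1) < y (-k) + 1 at h3
    linarith
  have hpos : 0 < k → 0 < y (k - 1) := by
    intro hk
    have := hd.pos (show k - 1 < k by omega)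
    rwa [← oddExtension_natCast x, Nat.cast_sub (by omega), Nat.cast_one] at this
  let I : Finset ℤ := Finset.Ico (-k : ℤ) k
  obtain ⟨v, hlo, hhi⟩ := Order.exists_between_finsets
    (({0} ∪ I.image y ∪ (I.filter fun j => (u : ℤ) ≤ k - j).image (y · + 1)) ∪
      if u ≤ 2 * k + 1 then {1 / 2} else ∅)
    ((I.filter fun j => k - j < (u : ℤ)).image (y · + 1) ∪
      if 2 * k + 1 < u then {1 / 2} else ∅) (by
    have mem : ∀ (p : Prop) [Decidable p] (z : ℝ),
        z ∈ (if p then {1 / 2} else ∅ : Finset ℝ) ↔ p ∧ z = 1 / 2 := by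
      intro p _ z
      split_ifs <;> simp_all
    intro l hl w hw
    simp only [Finset.mem_union, Finset.mem_image, Finset.mem_filter, Finset.mem_singleton,
      mem, I, Finset.mem_Ico] at hl hw
    rcases hw with ⟨j, ⟨⟨hj, hj'⟩, hju⟩, rfl⟩ | ⟨hku, rfl⟩
    · have h1 := htop j hj hj' hju
      have h2 := hpos (by omega)
      rcases hl with ((rfl | ⟨i, ⟨hi, hi'⟩, rfl⟩) | ⟨i, ⟨⟨hi, hi'⟩, hiu⟩, rfl⟩) | ⟨-, rfl⟩
      · linarith
      · linarith [hle i hi hi']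
      · linarith [hd i j hi (by omega) hj']
      -- Here `-y j ≤ y (k - 1) < y j + 1`, hence `1 / 2 < y j + 1`.
      · linarith [hge j hj hj']
    · rcases hl with ((rfl | ⟨i, ⟨hi, hi'⟩, rfl⟩) | ⟨i, ⟨⟨hi, hi'⟩, hiu⟩, rfl⟩) | ⟨hku', rfl⟩
      · norm_num
      · linarith [hle i hi hi', hsmall (by omega) hku]
      · omega
      · omega)
  simp only [Finset.mem_union, Finset.mem_image, Finset.mem_filter, Finset.mem_singleton, I,
    Finset.mem_Ico] at hlo hhi
  refine ⟨v, hlo 0 (by simp), fun j hj hj' => hlo _ (.inl (.inl (.inr ⟨j, ⟨hj, hj'⟩, rfl⟩))),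
    fun j hj hj' => ⟨fun h => hhi _ (.inl ⟨j, ⟨⟨hj, hj'⟩, h⟩, rfl⟩),
      fun h => hlo _ (.inl (.inr ⟨j, ⟨⟨hj, hj'⟩, h⟩, rfl⟩))⟩,
    fun h => hhi _ (.inr (by simp [h])), fun h => hlo _ (.inr (by simp [h]))⟩

lemma exists_isDominant_isCodeOf {n : ℕ} {c : List ℕ} (hc : c ∈ cellCodes n) :
    ∃ x : ℕ → ℝ, IsDominant n x ∧ IsCodeOf x c := by
  induction n generalizing c with
  | zero =>
    refine ⟨0, fun a b _ _ _ => by omega, ?_⟩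
    simp only [cellCodes, Finset.mem_singleton] at hc
    subst hc
    trivial
  | succ k ih =>
    obtain ⟨d, hdk, u, hu, rfl⟩ := mem_cellCodes_succ.1 hc
    obtain ⟨x, hd, hx⟩ := ih hdk
    have hlen := length_of_mem_cellCodes hdk
    obtain ⟨v, hv0, hv1, hv2, hv3, hv4⟩ := exists_next_coordinate hd (t := d.headD 0) (by
      intro hk
      cases d with
      | nil => simp at hlen; omega
      | cons t d => simpa [← hlen] using hx.1) hu
    have hu1 := (Finset.mem_Icc.1 hu).1
    have hold : ∀ i < k, x i = Function.update x k v i := fun i hi => by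
      rw [Function.update_of_ne hi.ne]
    have hnew : oddExtension (Function.update x k v) k = v := by simp
    have hnew' : oddExtension (Function.update x k v) (-1 - k) = -v := by
      rw [oddExtension_reflect, hnew]
    refine ⟨Function.update x k v, ?_, ?_, hx.congr (by rwa [hlen])⟩
    · apply isDominant_of_pos_of_lt
      · intro i hi
        rcases eq_or_lt_of_le (Nat.lt_succ_iff.1 hi) with rfl | h
        · simpa
        · rw [← hold i h]
          exact hd.pos h
      · intro i j hij hj
        rw [← hold i (by omega)]
        rcases eq_or_lt_of_le (Nat.lt_succ_iff.1 hj) with rfl | h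
        · simpa using hv1 i (by omega) (by omega)
        · rw [← hold j h]
          simpa using hd i j (by omega) (by omega) (by omega)
    · rw [hlen]
      intro j hj hj'
      rw [hnew]
      rcases eq_or_lt_of_le hj with rfl | h1
      · rw [hnew']
        exact ⟨fun h => by linarith [hv3 (by omega)], fun h => by linarith [hv4 (by omega)]⟩
      rcases eq_or_lt_of_le hj' with rfl | h2
      · rw [hnew]
        exact ⟨fun _ => by linarith, fun h => by omega⟩
      · rw [← oddExtension_congr hold (by omega) h2]
        exact hv2 j (by omega) h2

lemma exists_mem_cellCodes {n : ℕ} {x : ℕ → ℝ} (hd : IsDominant n x)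
    (hg : ∀ a b : ℤ, -n ≤ a → b < n → a ≤ b → oddExtension x a + 1 ≠ oddExtension x b) :
    ∃ c ∈ cellCodes n, IsCodeOf x c := by
  classical
  induction n with
  | zero => exact ⟨[], by simp [cellCodes], trivial⟩
  | succ n ih =>
    obtain ⟨c, hc, hcx⟩ := ih (hd.mono (by omega))
      (fun a b ha hb hab => hg a b (by push_cast; omega) (by push_cast; omega) hab)
    have hlen := length_of_mem_cellCodes hc
    -- The window size is the first offset that leaves the window; `2 * n + 2` is a sentinel, one
    -- past the offset of `-x n`.
    have hex : ∃ r : ℕ, ¬ (oddExtension x n < oddExtension x (n - r) + 1) ∨ r = 2 * n + 2 :=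
      ⟨_, .inr rfl⟩
    obtain ⟨u, hu, hmin⟩ : ∃ u : ℕ,
        (¬ (oddExtension x n < oddExtension x (n - u) + 1) ∨ u = 2 * n + 2) ∧
        ∀ r < u, oddExtension x n < oddExtension x (n - r) + 1 ∧ r ≠ 2 * n + 2 := by
      refine ⟨Nat.find hex, Nat.find_spec hex, fun r hr => ?_⟩
      have := Nat.find_min hex hr
      tauto
    have hle : u ≤ 2 * n + 2 := by
      by_contra h
      exact (hmin (2 * n + 2) (by omega)).2 rfl
    have hw : IsWindow x n u := by
      intro j hj hj'
      refine ⟨fun h => ?_, fun h => ?_⟩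
      · have := (hmin (n - j).toNat (by omega)).1
        rwa [Int.toNat_of_nonneg (by omega), sub_sub_cancel] at this
      · rcases hu with hu | hu
        · refine lt_of_le_of_ne ?_ (hg j n (by push_cast; omega) (by push_cast; omega) hj')
          refine le_trans ?_ (not_lt.1 hu)
          rcases eq_or_lt_of_le (show j ≤ n - u by omega) with rfl | h'
          · exact le_rfl
          · have := hd j (n - u) (by push_cast; omega) h' (by push_cast; omega)
            linarith
        · omega
    refine ⟨u :: c, mem_cellCodes_succ.2 ⟨c, hc, u, ?_, rfl⟩, by rwa [hlen], hcx⟩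
    have hu0 : 1 ≤ u := by
      by_contra h0
      have := (hw n (by omega) le_rfl).2 (by omega)
      linarith
    have ht := headD_le_of_mem_cellCodes hc
    rw [nextValues, Finset.mem_Icc]
    refine ⟨hu0, ?_⟩
    split_ifs with h
    · exact hle
    by_contra hut
    cases c with
    | nil => simp at hlen h; omega
    | cons t d =>
      simp only [List.headD_cons, List.length_cons] at *
      -- The first index outside the previous window would lie inside the new one, although `x` has
      -- increased.
      have h1 := (hcx.1 (n - 1 - t) (by omega) (by omega)).2 (by omega)
      have h2 := (hw (n - 1 - t) (by omega) (by omega)).1 (by omega)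
      have h3 := hd d.length n (by push_cast; omega) (by omega) (by push_cast; omega)
      linarith

lemma IsCodeOf.isWindow_iff {n : ℕ} {x x' : ℕ → ℝ} {c : List ℕ} (hlen : c.length = n)
    (h : IsCodeOf x c) (h' : IsCodeOf x' c) {a b : ℤ} (ha : -1 - b ≤ a) (hab : a ≤ b)
    (hb : b < n) :
    oddExtension x a + 1 ≠ oddExtension x b ∧
    (oddExtension x a + 1 < oddExtension x b ↔ oddExtension x' a + 1 < oddExtension x' b) := by
  induction c generalizing n with
  | nil => simp at hlen; omega
  | cons u c ih =>
    simp only [List.length_cons] at hlen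
    by_cases hbn : b < c.length
    · exact ih rfl h.2 h'.2 hbn
    · obtain rfl : b = c.length := by omega
      have h1 := h.1 a ha hab
      have h2 := h'.1 a ha hab
      by_cases hu : c.length - a < u
      · have h3 := h1.1 hu
        have h4 := h2.1 hu
        exact ⟨h3.ne', fun h => by linarith, fun h => by linarith⟩
      · have h3 := h1.2 (by omega)
        have h4 := h2.2 (by omega)
        exact ⟨h3.ne, fun _ => h4, fun _ => h3⟩

/-- If `u' < u`, the index `k - u'` is inside one window and outside the other. -/
lemma IsWindow.le {x x' : ℕ → ℝ} {k u u' : ℕ} (hu : u ≤ 2 * k + 2) (h : IsWindow x k u)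
    (h' : IsWindow x' k u') (hxx' : ∀ j : ℤ, -1 - k ≤ j → j ≤ k →
      (oddExtension x j + 1 < oddExtension x k ↔ oddExtension x' j + 1 < oddExtension x' k)) :
    u ≤ u' := by
  by_contra hlt
  have h1 := (h (k - u') (by omega) (by omega)).1 (by omega)
  have h2 := (h' (k - u') (by omega) (by omega)).2 (by omega)
  have h3 := (hxx' (k - u') (by omega) (by omega)).2 h2
  linarith

lemma IsCodeOf.unique {n : ℕ} {x x' : ℕ → ℝ} {c c' : List ℕ} (hc : c ∈ cellCodes n)
    (hc' : c' ∈ cellCodes n) (h : IsCodeOf x c) (h' : IsCodeOf x' c')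
    (hxx' : ∀ a b : ℤ, -n ≤ a → a < n → -n ≤ b → b < n →
      (oddExtension x a + 1 < oddExtension x b ↔ oddExtension x' a + 1 < oddExtension x' b)) :
    c = c' := by
  induction n generalizing c c' with
  | zero => simp_all [cellCodes]
  | succ n ih =>
    have hu := headD_le_of_mem_cellCodes hc
    have hu' := headD_le_of_mem_cellCodes hc'
    obtain ⟨d, hd, u, -, rfl⟩ := mem_cellCodes_succ.1 hc
    obtain ⟨d', hd', u', -, rfl⟩ := mem_cellCodes_succ.1 hc'
    have hw := h.1
    have hw' := h'.1
    rw [length_of_mem_cellCodes hd] at hw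
    rw [length_of_mem_cellCodes hd'] at hw'
    have hxx : ∀ j : ℤ, -1 - n ≤ j → j ≤ n →
      (oddExtension x j + 1 < oddExtension x n ↔ oddExtension x' j + 1 < oddExtension x' n) :=
      fun j hj hj' => hxx' j n (by push_cast; omega) (by push_cast; omega)
        (by push_cast; omega) (by push_cast; omega)
    rw [ih hd hd' h.2 h'.2 fun a b ha ha' hb hb' => hxx' a b (by push_cast; omega)
      (by push_cast; omega) (by push_cast; omega) (by push_cast; omega)]
    simp only [List.headD_cons] at hu hu'
    rw [le_antisymm (hw.le (by omega) hw' hxx)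
      (hw'.le (by omega) hw fun j hj hj' => (hxx j hj hj').symm)]

/-! ### Components of the complement of affine hyperplanes -/

/-- By the intermediate value theorem no `f i` changes sign on the component; conversely a sign cell
is an intersection of half-spaces, hence convex. -/
lemma connectedComponentIn_eq_signCell {ι E : Type*} [AddCommGroup E] [Module ℝ E]
    [TopologicalSpace E] [ContinuousAdd E] [ContinuousSMul ℝ E] (f : ι → E →ᵃ[ℝ] ℝ)
    (hf : ∀ i, Continuous (f i)) {U : Set E} (hU : U = {x | ∀ i, f i x ≠ 0}) {x : E}
    (hx : x ∈ U) :
    connectedComponentIn U x = {z ∈ U | ∀ i, 0 < f i z ↔ 0 < f i x} := by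
  subst hU
  apply Set.Subset.antisymm
  · intro z hz
    have hsub := connectedComponentIn_subset {x | ∀ i, f i x ≠ 0} x
    have hxm := mem_connectedComponentIn hx
    refine ⟨hsub hz, fun i => ?_⟩
    have hp := isPreconnected_connectedComponentIn (F := {x | ∀ i, f i x ≠ 0}) (x := x)
    have key : ∀ v ∈ connectedComponentIn {x | ∀ i, f i x ≠ 0} x,
        ∀ w ∈ connectedComponentIn {x | ∀ i, f i x ≠ 0} x, 0 < f i v → 0 < f i w := by
      intro v hv w hw hpos
      by_contra hneg
      obtain ⟨p, hp, hp0⟩ := hp.intermediate_value hw hv (hf i).continuousOn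
        ⟨not_lt.1 hneg, hpos.le⟩
      exact hsub hp i hp0
    exact ⟨key z hz x hxm, key x hxm z hz⟩
  · apply IsPreconnected.subset_connectedComponentIn
    · have hc : {z ∈ {x | ∀ i, f i x ≠ 0} | ∀ i, 0 < f i z ↔ 0 < f i x} =
          ⋂ i, f i ⁻¹' (if 0 < f i x then Set.Ioi 0 else Set.Iio 0) := by
        ext z
        simp only [Set.mem_ofPred_eq, Set.mem_iInter, Set.mem_preimage, ← forall_and]
        refine forall_congr' fun i => ?_
        split_ifs with h
        · simp only [h, iff_true, Set.mem_Ioi]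
          exact ⟨fun h => h.2, fun h => ⟨h.ne', h⟩⟩
        · simp only [h, iff_false, Set.mem_Iio, not_lt]
          exact ⟨fun h => lt_of_le_of_ne h.2 h.1, fun h => ⟨h.ne, h.le⟩⟩
      rw [hc]
      apply Convex.isPreconnected
      refine convex_iInter fun i => ?_
      apply Convex.affine_preimage
      split_ifs
      · exact convex_Ioi 0
      · exact convex_Iio 0
    · exact ⟨hx, fun _ => Iff.rfl⟩
    · exact fun z hz => hz.1

/-! ### Cells of the type `C` Catalan arrangement -/

/-- The coordinate `± x i`. -/
def signedCoord {n : ℕ} (x : Fin n → ℝ) (a : Fin n × ℤˣ) : ℝ := ((a.2 : ℤ) : ℝ) * x a.1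

lemma signedCoord_one {n : ℕ} (x : Fin n → ℝ) (i : Fin n) : signedCoord x (i, 1) = x i := by
  simp [signedCoord]

lemma signedCoord_neg {n : ℕ} (x : Fin n → ℝ) (i : Fin n) (e : ℤˣ) :
    signedCoord x (i, -e) = -signedCoord x (i, e) := by
  simp [signedCoord]

lemma signedCoord_neg_one {n : ℕ} (x : Fin n → ℝ) (i : Fin n) :
    signedCoord x (i, -1) = -x i := by
  rw [signedCoord_neg, signedCoord_one]

/-- The point `x` lies on no hyperplane of the type `C` Catalan arrangement. -/
def IsGeneric {n : ℕ} (x : Fin n → ℝ) : Prop :=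
  ∀ a b : Fin n × ℤˣ, a ≠ b →
    signedCoord x a ≠ signedCoord x b ∧ signedCoord x a + 1 ≠ signedCoord x b

/-- The points `x` and `z` lie on the same sides of the hyperplanes. -/
def SameSide {n : ℕ} (x z : Fin n → ℝ) : Prop :=
  ∀ a b : Fin n × ℤˣ, (signedCoord x a < signedCoord x b ↔ signedCoord z a < signedCoord z b) ∧
    (signedCoord x a + 1 < signedCoord x b ↔ signedCoord z a + 1 < signedCoord z b)

lemma compl_sUnion_typeCCatalanArrangement (n : ℕ) :
    (⋃₀ typeCCatalanArrangement n)ᶜ = {x | IsGeneric x} := by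
  have hmem : ∀ x : Fin n → ℝ, x ∈ ⋃₀ typeCCatalanArrangement n ↔
      ∃ s ∈ ({-1, 0, 1} : Set ℝ), (∃ i j : Fin n, i < j ∧ x i - x j = s) ∨
        (∃ i j : Fin n, i < j ∧ x i + x j = s) ∨ ∃ i : Fin n, 2 * x i = s := by
    intro x
    simp only [typeCCatalanArrangement, Set.mem_sUnion, Set.mem_ofPred_eq]
    constructor
    · rintro ⟨H, ⟨s, hs, ⟨i, j, hij, rfl⟩ | ⟨i, j, hij, rfl⟩ | ⟨i, rfl⟩⟩, hx⟩
      · exact ⟨s, hs, .inl ⟨i, j, hij, hx⟩⟩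
      · exact ⟨s, hs, .inr (.inl ⟨i, j, hij, hx⟩)⟩
      · exact ⟨s, hs, .inr (.inr ⟨i, hx⟩)⟩
    · rintro ⟨s, hs, ⟨i, j, hij, hx⟩ | ⟨i, j, hij, hx⟩ | ⟨i, hx⟩⟩
      · exact ⟨_, ⟨s, hs, .inl ⟨i, j, hij, rfl⟩⟩, hx⟩
      · exact ⟨_, ⟨s, hs, .inr (.inl ⟨i, j, hij, rfl⟩)⟩, hx⟩
      · exact ⟨_, ⟨s, hs, .inr (.inr ⟨i, rfl⟩)⟩, hx⟩
  ext x
  rw [Set.mem_compl_iff, hmem, Set.mem_ofPred_eq]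
  push Not
  constructor
  · intro h
    have hm := h (-1) (by simp)
    have h0 := h 0 (by simp)
    have h1 := h 1 (by simp)
    have hsub : ∀ i j, i ≠ j → x i ≠ x j ∧ x i + 1 ≠ x j := by
      intro i j hij
      rcases lt_or_gt_of_ne hij with hlt | hlt
      · exact ⟨fun he => h0.1 i j hlt (by linarith), fun he => hm.1 i j hlt (by linarith)⟩
      · exact ⟨fun he => h0.1 j i hlt (by linarith), fun he => h1.1 j i hlt (by linarith)⟩
    -- The case `i = j` is where the hyperplanes `2 * x i = s` enter.
    have hadd : ∀ i j, x i + x j ≠ 0 ∧ x i + x j ≠ 1 ∧ x i + x j ≠ -1 := by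
      intro i j
      rcases lt_trichotomy i j with hlt | rfl | hlt
      · exact ⟨h0.2.1 i j hlt, h1.2.1 i j hlt, hm.2.1 i j hlt⟩
      · rw [← two_mul]
        exact ⟨h0.2.2 i, h1.2.2 i, hm.2.2 i⟩
      · rw [add_comm]
        exact ⟨h0.2.1 j i hlt, h1.2.1 j i hlt, hm.2.1 j i hlt⟩
    rintro ⟨i, e⟩ ⟨j, f⟩ hab
    rcases Int.units_eq_one_or e with rfl | rfl <;>
      rcases Int.units_eq_one_or f with rfl | rfl <;>
      simp only [signedCoord_one, signedCoord_neg_one]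
    · exact hsub i j fun hij => hab (by rw [hij])
    · exact ⟨fun he => (hadd i j).1 (by linarith), fun he => (hadd i j).2.2 (by linarith)⟩
    · exact ⟨fun he => (hadd i j).1 (by linarith), fun he => (hadd i j).2.1 (by linarith)⟩
    · have := hsub j i fun hij => hab (by rw [hij])
      exact ⟨fun he => this.1 (by linarith), fun he => this.2 (by linarith)⟩
  · intro h s hs
    have hpm : ∀ i j, x i + x j ≠ s := by
      intro i j he
      have h1 := h (i, 1) (j, -1) (by simp)
      have h2 := h (j, -1) (i, 1) (by simp)
      simp only [signedCoord_one, signedCoord_neg_one] at h1 h2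
      rcases hs with rfl | rfl | rfl
      · exact h1.2 (by linarith)
      · exact h1.1 (by linarith)
      · exact h2.2 (by linarith)
    refine ⟨fun i j hij he => ?_, fun i j _ => hpm i j, fun i => by rw [two_mul]; exact hpm i i⟩
    have h1 := h (i, 1) (j, 1) (by simp [hij.ne])
    have h2 := h (j, 1) (i, 1) (by simp [hij.ne'])
    simp only [signedCoord_one] at h1 h2
    rcases hs with rfl | rfl | rfl
    · exact h1.2 (by linarith)
    · exact h1.1 (by linarith)
    · exact h2.2 (by linarith)

/-- The linear form minus constant whose sign compares two signed coordinates. -/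
def sideForm {n : ℕ} (p : ((Fin n × ℤˣ) × (Fin n × ℤˣ)) × Bool) : (Fin n → ℝ) →ᵃ[ℝ] ℝ :=
  (((p.1.2.2 : ℤ) : ℝ) • LinearMap.proj p.1.2.1 -
    ((p.1.1.2 : ℤ) : ℝ) • LinearMap.proj p.1.1.1 : (Fin n → ℝ) →ₗ[ℝ] ℝ).toAffineMap -
    AffineMap.const ℝ _ (if p.2 then 1 else 0)

lemma sideForm_apply {n : ℕ} (p : ((Fin n × ℤˣ) × (Fin n × ℤˣ)) × Bool) (x : Fin n → ℝ) :
    sideForm p x = signedCoord x p.1.2 - signedCoord x p.1.1 - if p.2 then 1 else 0 := by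
  simp [sideForm, signedCoord]

lemma connectedComponentIn_isGeneric {n : ℕ} {x : Fin n → ℝ} (hx : IsGeneric x) :
    connectedComponentIn {x : Fin n → ℝ | IsGeneric x} x =
      {z | IsGeneric z ∧ SameSide z x} := by
  rw [connectedComponentIn_eq_signCell
    -- Diagonal pairs are excluded: with constant `0` their form vanishes identically.
    (fun p : {p : ((Fin n × ℤˣ) × (Fin n × ℤˣ)) × Bool // p.1.1 ≠ p.1.2} => sideForm p.1)
    (fun p => AffineMap.continuous_of_finiteDimensional _) _ hx]
  · ext z
    refine and_congr_right fun _ => ⟨fun h a b => ?_, ?_⟩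
    · by_cases hab : a = b
      · subst hab
        simp
      · have h0 := h ⟨((a, b), false), hab⟩
        have h1 := h ⟨((a, b), true), hab⟩
        simp only [sideForm_apply, Bool.false_eq_true, if_false, if_true,
          lt_sub_iff_add_lt', add_zero] at h0 h1
        exact ⟨h0, h1⟩
    · rintro h ⟨⟨⟨a, b⟩, s⟩, -⟩
      cases s
      · simpa [sideForm_apply, sub_pos] using (h a b).1
      · simpa [sideForm_apply, sub_pos, lt_sub_iff_add_lt'] using (h a b).2
  · ext z
    constructor
    · rintro h ⟨⟨⟨a, b⟩, s⟩, hab⟩ h0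
      rw [sideForm_apply] at h0
      cases s
      · exact (h a b hab).1 (by simp at h0; linarith)
      · exact (h a b hab).2 (by simp at h0; linarith)
    · intro h a b hab
      have h0 := h ⟨((a, b), false), hab⟩
      have h1 := h ⟨((a, b), true), hab⟩
      simp only [sideForm_apply, Bool.false_eq_true, if_false, if_true, sub_zero] at h0 h1
      exact ⟨fun he => h0 (by linarith), fun he => h1 (by linarith)⟩

/-! ### Signed permutations -/

/-- The point with coordinates `ε i * z (σ i)`. -/
def signedPermute {n : ℕ} (ε : Fin n → ℤˣ) (σ : Equiv.Perm (Fin n)) (z : Fin n → ℝ) :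
    Fin n → ℝ := fun i => ((ε i : ℤ) : ℝ) * z (σ i)

lemma signedCoord_signedPermute {n : ℕ} (ε : Fin n → ℤˣ) (σ : Equiv.Perm (Fin n))
    (z : Fin n → ℝ) (a : Fin n × ℤˣ) :
    signedCoord (signedPermute ε σ z) a = signedCoord z (σ a.1, a.2 * ε a.1) := by
  simp [signedCoord, signedPermute, mul_assoc]

lemma signedCoord_eq_signedPermute {n : ℕ} (ε : Fin n → ℤˣ) (σ : Equiv.Perm (Fin n))
    (z : Fin n → ℝ) (a : Fin n × ℤˣ) :
    signedCoord z a =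
      signedCoord (signedPermute ε σ z) (σ.symm a.1, a.2 * ε (σ.symm a.1)) := by
  rw [signedCoord_signedPermute]
  simp [mul_assoc, Int.units_mul_self]

lemma IsGeneric.signedPermute {n : ℕ} {z : Fin n → ℝ} (hz : IsGeneric z) (ε : Fin n → ℤˣ)
    (σ : Equiv.Perm (Fin n)) : IsGeneric (signedPermute ε σ z) := by
  intro a b hab
  rw [signedCoord_signedPermute, signedCoord_signedPermute]
  refine hz _ _ fun h => hab ?_
  obtain ⟨i, e⟩ := a
  obtain ⟨j, f⟩ := b
  simp only [Prod.mk.injEq, EmbeddingLike.apply_eq_iff_eq] at h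
  obtain ⟨rfl, h⟩ := h
  rw [mul_left_injective _ h]

lemma IsGeneric.of_signedPermute {n : ℕ} {z : Fin n → ℝ} {ε : Fin n → ℤˣ}
    {σ : Equiv.Perm (Fin n)} (hz : IsGeneric (_root_.signedPermute ε σ z)) : IsGeneric z := by
  intro a b hab
  rw [signedCoord_eq_signedPermute ε σ, signedCoord_eq_signedPermute ε σ z b]
  refine hz _ _ fun h => hab ?_
  obtain ⟨i, e⟩ := a
  obtain ⟨j, f⟩ := b
  simp only [Prod.mk.injEq, EmbeddingLike.apply_eq_iff_eq] at h
  obtain ⟨rfl, h⟩ := h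
  rw [mul_left_injective _ h]

lemma SameSide.signedPermute {n : ℕ} {z z' : Fin n → ℝ} (h : SameSide z z')
    (ε : Fin n → ℤˣ) (σ : Equiv.Perm (Fin n)) :
    SameSide (signedPermute ε σ z) (signedPermute ε σ z') := by
  intro a b
  simp only [signedCoord_signedPermute]
  exact h _ _

lemma SameSide.of_signedPermute {n : ℕ} {z z' : Fin n → ℝ} {ε : Fin n → ℤˣ}
    {σ : Equiv.Perm (Fin n)} (h : SameSide (_root_.signedPermute ε σ z) (_root_.signedPermute ε σ z')) :
    SameSide z z' := by
  intro a b
  rw [signedCoord_eq_signedPermute ε σ, signedCoord_eq_signedPermute ε σ z b,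
    signedCoord_eq_signedPermute ε σ z', signedCoord_eq_signedPermute ε σ z' b]
  exact h _ _

/-- Comparing each coordinate with its negative recovers the signs; comparing absolute values
recovers the permutation, since `Fin n` has only the trivial order automorphism. -/
lemma SameSide.signs_perm_eq {n : ℕ} {z z' : Fin n → ℝ} {ε ε' : Fin n → ℤˣ}
    {σ σ' : Equiv.Perm (Fin n)} (hz : StrictMono z) (hz' : StrictMono z')
    (hpos : ∀ i, 0 < z i) (hpos' : ∀ i, 0 < z' i)
    (h : SameSide (_root_.signedPermute ε σ z) (_root_.signedPermute ε' σ' z')) :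
    ε = ε' ∧ σ = σ' := by
  have hε : ε = ε' := by
    funext i
    have h1 := (h (i, -1) (i, 1)).1
    simp only [signedCoord_neg_one, signedCoord_one, _root_.signedPermute] at h1
    have this0 := hpos (σ i)
    have this1 := hpos' (σ' i)
    rcases Int.units_eq_one_or (ε i) with h2 | h2 <;>
      rcases Int.units_eq_one_or (ε' i) with h3 | h3 <;> rw [h2, h3] at h1 ⊢ <;> exfalso
    · simp at h1
      linarith [h1.1 this0]
    · simp at h1
      linarith [h1.2 this1]
  subst hε
  refine ⟨rfl, ?_⟩
  have hlt : ∀ i j, σ i < σ j ↔ σ' i < σ' j := by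
    intro i j
    have h1 := (h (i, ε i) (j, ε j)).1
    simp only [signedCoord_signedPermute, Int.units_mul_self, signedCoord_one] at h1
    rwa [hz.lt_iff_lt, hz'.lt_iff_lt] at h1
  let φ : Fin n ≃o Fin n := (StrictMono.orderIsoOfSurjective (fun i => σ' (σ.symm i))
    (fun i j hij => by rw [← hlt]; simpa) (σ'.surjective.comp σ.symm.surjective))
  have hφ : φ = OrderIso.refl _ := Subsingleton.elim _ _
  ext i
  have : φ (σ i) = σ i := by rw [hφ]; rfl
  have h' : φ (σ i) = σ' (σ.symm (σ i)) := rfl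
  rw [← this, h', Equiv.symm_apply_apply]

/-- Sort the absolute values; genericity makes them positive and distinct. -/
lemma IsGeneric.exists_signedPermute {n : ℕ} {x : Fin n → ℝ} (hx : IsGeneric x) :
    ∃ ε σ z, StrictMono z ∧ (∀ i, 0 < z i) ∧ x = _root_.signedPermute ε σ z := by
  have habs : ∀ i, |x i| = signedCoord x (i, if 0 < x i then 1 else -1) := by
    intro i
    split_ifs with h
    · rw [signedCoord_one, abs_of_pos h]
    · rw [signedCoord_neg_one, abs_of_nonpos (not_lt.1 h)]
  refine ⟨fun i => if 0 < x i then 1 else -1, (Tuple.sort fun i => |x i|).symm,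
    (fun i => |x i|) ∘ Tuple.sort fun i => |x i|, ?_, ?_, ?_⟩
  · refine (Tuple.monotone_sort _).strictMono_of_injective (Function.Injective.comp ?_
      (Equiv.injective _))
    intro i j hij
    by_contra hne
    simp only [habs] at hij
    exact (hx _ _ (fun h => hne (congrArg Prod.fst h))).1 hij
  · intro i
    refine abs_pos.2 fun h0 => ?_
    have := (hx ((Tuple.sort fun i => |x i|) i, 1)
      ((Tuple.sort fun i => |x i|) i, -1) (by simp)).1
    rw [signedCoord_one, signedCoord_neg_one, h0] at this
    simp at this
  · funext i
    simp only [_root_.signedPermute, Function.comp_apply, Equiv.apply_symm_apply]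
    split_ifs with h
    · simp [abs_of_pos h]
    · simp [abs_of_nonpos (not_lt.1 h)]

/-! ### Dominant points and signed coordinates -/

/-- The position of a signed coordinate in the order of a dominant point. -/
def signedIndex {n : ℕ} (a : Fin n × ℤˣ) : ℤ := if a.2 = 1 then a.1 else -1 - a.1

lemma signedIndex_bounds {n : ℕ} (a : Fin n × ℤˣ) :
    -n ≤ signedIndex a ∧ signedIndex a < n := by
  have := a.1.2
  unfold signedIndex
  split_ifs <;> constructor <;> omega

lemma signedIndex_injective {n : ℕ} : Function.Injective (signedIndex (n := n)) := by
  rintro ⟨i, e⟩ ⟨j, f⟩ h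
  simp only [signedIndex] at h
  have hne : (-1 : ℤˣ) ≠ 1 := by decide
  rcases Int.units_eq_one_or e with rfl | rfl <;>
    rcases Int.units_eq_one_or f with rfl | rfl <;> simp [hne] at h ⊢ <;> omega

lemma exists_signedIndex_eq {n : ℕ} {j : ℤ} (h : -n ≤ j) (h' : j < n) :
    ∃ a : Fin n × ℤˣ, signedIndex a = j := by
  by_cases hj : 0 ≤ j
  · exact ⟨(⟨j.toNat, by omega⟩, 1), by simp [signedIndex, hj]⟩
  · refine ⟨(⟨(-1 - j).toNat, by omega⟩, -1), ?_⟩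
    have hne : (-1 : ℤˣ) ≠ 1 := by decide
    simp only [signedIndex, hne, if_false]
    omega

lemma signedCoord_eq_oddExtension {n : ℕ} (x : ℕ → ℝ) (a : Fin n × ℤˣ) :
    signedCoord (fun i : Fin n => x i) a = oddExtension x (signedIndex a) := by
  obtain ⟨i, e⟩ := a
  have hne : (-1 : ℤˣ) ≠ 1 := by decide
  rcases Int.units_eq_one_or e with rfl | rfl
  · simp [signedCoord_one, signedIndex]
  · simp [signedCoord_neg_one, signedIndex, hne, oddExtension_reflect]

lemma IsDominant.lt_iff {n : ℕ} {x : ℕ → ℝ} (h : IsDominant n x) {a b : ℤ} (ha : -n ≤ a)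
    (ha' : a < n) (hb : -n ≤ b) (hb' : b < n) :
    oddExtension x a < oddExtension x b ↔ a < b := by
  refine ⟨fun hlt => ?_, fun hab => h a b ha hab hb'⟩
  by_contra hab
  rcases eq_or_lt_of_le (not_lt.1 hab) with rfl | hba
  · exact lt_irrefl _ hlt
  · exact lt_asymm hlt (h b a hb hba ha')

lemma IsCodeOf.add_one_lt_iff {n : ℕ} {x x' : ℕ → ℝ} {c : List ℕ} (hlen : c.length = n)
    (hd : IsDominant n x) (hd' : IsDominant n x') (h : IsCodeOf x c) (h' : IsCodeOf x' c)
    {a b : ℤ} (ha : -n ≤ a) (ha' : a < n) (hb : -n ≤ b) (hb' : b < n) :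
    oddExtension x a + 1 ≠ oddExtension x b ∧
    (oddExtension x a + 1 < oddExtension x b ↔ oddExtension x' a + 1 < oddExtension x' b) := by
  rcases le_or_gt a b with hab | hab
  · by_cases hr : -1 - b ≤ a
    · exact h.isWindow_iff hlen h' hr hab hb'
    -- Negation turns the pair `(a, b)` into `(-1 - b, -1 - a)`, which a window does cover.
    · have := h.isWindow_iff hlen h' (a := -1 - b) (b := -1 - a) (by omega) (by omega)
        (by omega)
      simp only [oddExtension_reflect] at this
      refine ⟨fun h => this.1 (by linarith), fun h => ?_, fun h => ?_⟩
      · linarith [this.2.1 (by linarith)]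
      · linarith [this.2.2 (by linarith)]
  · have h1 := hd b a hb hab ha'
    have h2 := hd' b a hb hab ha'
    exact ⟨fun h => by linarith, fun h => by linarith, fun h => by linarith⟩

lemma IsCodeOf.sameSide {n : ℕ} {x x' : ℕ → ℝ} {c : List ℕ} (hlen : c.length = n)
    (hd : IsDominant n x) (hd' : IsDominant n x') (h : IsCodeOf x c) (h' : IsCodeOf x' c) :
    SameSide (fun i : Fin n => x i) (fun i : Fin n => x' i) := by
  intro a b
  obtain ⟨ha, ha'⟩ := signedIndex_bounds a
  obtain ⟨hb, hb'⟩ := signedIndex_bounds b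
  simp only [signedCoord_eq_oddExtension]
  exact ⟨by rw [hd.lt_iff ha ha' hb hb', hd'.lt_iff ha ha' hb hb'],
    (h.add_one_lt_iff hlen hd hd' h' ha ha' hb hb').2⟩

lemma IsCodeOf.isGeneric {n : ℕ} {x : ℕ → ℝ} {c : List ℕ} (hlen : c.length = n)
    (hd : IsDominant n x) (h : IsCodeOf x c) : IsGeneric (fun i : Fin n => x i) := by
  intro a b hab
  obtain ⟨ha, ha'⟩ := signedIndex_bounds a
  obtain ⟨hb, hb'⟩ := signedIndex_bounds b
  simp only [signedCoord_eq_oddExtension]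
  refine ⟨fun he => ?_, (h.add_one_lt_iff hlen hd hd h ha ha' hb hb').1⟩
  rcases lt_or_gt_of_ne (signedIndex_injective.ne hab) with hlt | hlt
  · exact (hd _ _ ha hlt hb').ne he
  · exact (hd _ _ hb hlt ha').ne' he

/-! ### The count -/

/-- A dominant point with the code `c`. -/
noncomputable def codePoint {n : ℕ} (c : cellCodes n) : ℕ → ℝ :=
  (exists_isDominant_isCodeOf c.2).choose

lemma codePoint_isDominant {n : ℕ} (c : cellCodes n) : IsDominant n (codePoint c) :=
  (exists_isDominant_isCodeOf c.2).choose_spec.1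

lemma codePoint_isCodeOf {n : ℕ} (c : cellCodes n) : IsCodeOf (codePoint c) c :=
  (exists_isDominant_isCodeOf c.2).choose_spec.2

lemma IsDominant.strictMono {n : ℕ} {x : ℕ → ℝ} (h : IsDominant n x) :
    StrictMono fun i : Fin n => x i := by
  intro i j hij
  simpa using h i j (by omega) (by simpa) (by omega)

/-- The generic point given by signs, a permutation and the code of a dominant point. -/
noncomputable def cellPoint {n : ℕ} (p : (Fin n → ℤˣ) × Equiv.Perm (Fin n) × cellCodes n) :
    Fin n → ℝ :=
  signedPermute p.1 p.2.1 fun i => codePoint p.2.2 i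

lemma cellPoint_isGeneric {n : ℕ} (p : (Fin n → ℤˣ) × Equiv.Perm (Fin n) × cellCodes n) :
    IsGeneric (cellPoint p) :=
  ((codePoint_isCodeOf p.2.2).isGeneric (length_of_mem_cellCodes p.2.2.2)
    (codePoint_isDominant p.2.2)).signedPermute _ _

lemma cellPoint_eq_of_sameSide {n : ℕ}
    {p q : (Fin n → ℤˣ) × Equiv.Perm (Fin n) × cellCodes n}
    (h : SameSide (cellPoint p) (cellPoint q)) : p = q := by
  obtain ⟨ε, σ, c⟩ := p
  obtain ⟨ε', σ', c'⟩ := q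
  obtain ⟨rfl, rfl⟩ := h.signs_perm_eq (codePoint_isDominant c).strictMono
    (codePoint_isDominant c').strictMono (fun i => (codePoint_isDominant c).pos i.2)
    (fun i => (codePoint_isDominant c').pos i.2)
  have hs := h.of_signedPermute
  have : c = c' := by
    refine Subtype.ext ((codePoint_isCodeOf c).unique c.2 c'.2 (codePoint_isCodeOf c') ?_)
    intro a b ha ha' hb hb'
    obtain ⟨a, rfl⟩ := exists_signedIndex_eq ha ha'
    obtain ⟨b, rfl⟩ := exists_signedIndex_eq hb hb'
    have := (hs a b).2
    simpa only [signedCoord_eq_oddExtension] using this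
  rw [this]

lemma IsGeneric.exists_sameSide_cellPoint {n : ℕ} {x : Fin n → ℝ} (hx : IsGeneric x) :
    ∃ p, SameSide x (cellPoint p) := by
  obtain ⟨ε, σ, z, hz, hpos, rfl⟩ := hx.exists_signedPermute
  -- The padding by `0` is harmless: only the first `n` terms are ever used.
  obtain ⟨w, rfl⟩ : ∃ w : ℕ → ℝ, z = fun i : Fin n => w i :=
    ⟨fun i => if h : i < n then z ⟨i, h⟩ else 0, by funext i; simp⟩
  have hg := hx.of_signedPermute
  have hd : IsDominant n w := isDominant_of_pos_of_lt (fun i hi => hpos ⟨i, hi⟩)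
    fun i j hij hj => hz (show (⟨i, hij.trans hj⟩ : Fin n) < ⟨j, hj⟩ from hij)
  obtain ⟨c, hc, hw⟩ := exists_mem_cellCodes hd (by
    intro a b ha hb hab he
    obtain ⟨a, rfl⟩ := exists_signedIndex_eq ha (hab.trans_lt hb)
    obtain ⟨b, rfl⟩ := exists_signedIndex_eq (ha.trans hab) hb
    rw [← signedCoord_eq_oddExtension, ← signedCoord_eq_oddExtension] at he
    by_cases hab' : a = b
    · subst hab'
      linarith
    · exact (hg a b hab').2 he)
  exact ⟨(ε, σ, ⟨c, hc⟩), (hw.sameSide (length_of_mem_cellCodes hc) hd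
    (codePoint_isDominant ⟨c, hc⟩) (codePoint_isCodeOf ⟨c, hc⟩)).signedPermute ε σ⟩

lemma arrangementRegions_eq_range (n : ℕ) :
    arrangementRegions (typeCCatalanArrangement n) =
      Set.range fun p : (Fin n → ℤˣ) × Equiv.Perm (Fin n) × cellCodes n =>
        {z | IsGeneric z ∧ SameSide z (cellPoint p)} := by
  ext R
  simp only [arrangementRegions, compl_sUnion_typeCCatalanArrangement, Set.mem_ofPred_eq,
    Set.mem_range]
  constructor
  · rintro ⟨x, hx, rfl⟩
    obtain ⟨p, hp⟩ := hx.exists_sameSide_cellPoint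
    refine ⟨p, ?_⟩
    rw [connectedComponentIn_isGeneric hx]
    ext z
    refine and_congr_right fun _ => forall_congr' fun a => forall_congr' fun b => ?_
    rw [(hp a b).1, (hp a b).2]
  · rintro ⟨p, rfl⟩
    exact ⟨_, cellPoint_isGeneric p, (connectedComponentIn_isGeneric (cellPoint_isGeneric p)).symm⟩

theorem mainTheorem1 (n : ℕ) :
    (arrangementRegions (typeCCatalanArrangement n)).encard =
      ((2 ^ n * Nat.factorial n * Nat.choose (2 * n) n : ℕ) : ℕ∞) := by
  rw [arrangementRegions_eq_range, ← Set.image_univ, Function.Injective.encard_image,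
    Set.encard_univ, ENat.card_eq_coe_fintype_card]
  · simp [Fintype.card_perm, card_cellCodes, mul_assoc]
  · intro p q hpq
    have : cellPoint p ∈ {z | IsGeneric z ∧ SameSide z (cellPoint p)} :=
      ⟨cellPoint_isGeneric p, fun _ _ => ⟨Iff.rfl, Iff.rfl⟩⟩
    simp only at hpq
    rw [hpq] at this
    exact cellPoint_eq_of_sameSide this.2
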